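/- Let $k$ be a field of characteristic $0$, let $R=k[x_1,x_2,\dots]$ be the polynomial ring in countably many variables, and let $D$ be the $k$-linear derivation of $R$ with $D(x_i)=x_{i+1}$ for all $i\ge 1$. For $S\subseteq R$ let $[S]$ denote the differential ideal generated by $S$, i.e. the ideal generated by all $D^i(h)$ with $h\in S$, $i\ge 0$. Order the monomials of $R$ by the weighted lexicographic order: give $x_i$ weight $i$, compare weights first, and compare monomials of equal weight lexicographically, looking at the exponents of $x_1$, then $x_2$, and so on; at the first index where the exponents differ, the monomial with the larger exponent is the larger one. For a nonzero polynomial $f$ let $\mathrm{In}(f)$ be its largest monomial, put $\mathrm{In}(0)=0$, and for an ideal $J$ let $\mathrm{In}(J)=(\mathrm{In}(f) : f\in J)$. Say that $J$ has a differentially finite Groebner basis if there are finitely many polynomials $h_1,\dots,h_r\in R$ with $J=[h_1,\dots,h_r]$ and $\mathrm{In}(J)=(\mathrm{In}(D^i(h_j)) : 1\le j\le r,\ i\ge 0)$. **Theorem.** The ideal $I=[x_1^2]$ does not have a differentially finite Groebner basis with respect to the weighted lexicographic order. Moreover, even without the requirement $I=[h_1,\dots,h_r]$, there are no finitely many polynomials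 $h_1,\dots,h_r\in R$ with $\mathrm{In}(I)=(\mathrm{In}(D^i(h_j)) : 1\le j\le r,\ i\ge 0)$. -/

import Mathlib

open MvPolynomial

namespace DiffGroebner

/-- The weight `∑ i * a i` of the monomial `∏ x_i ^ (a i)`, where `x_i` has weight `i`. -/
noncomputable def wt : (ℕ+ →₀ ℕ) →+ ℕ := Finsupp.weight (fun i : ℕ+ => (i : ℕ))

/-- Exponent vectors of monomials in `x_1, x_2, …`, as a type synonym that carries the weighted
lexicographic order. -/
structure WLex where
  /-- the underlying exponent vector -/
  exps : ℕ+ →₀ ℕ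

namespace WLex

/-- The tautological bijection. -/
def equiv : WLex ≃ (ℕ+ →₀ ℕ) := ⟨exps, mk, fun _ => rfl, fun _ => rfl⟩

noncomputable instance : AddCommMonoid WLex := equiv.addCommMonoid

/-- The pair (weight, exponent vector), in the lexicographic product of `ℕ` and the
lexicographic order on exponent vectors. -/
noncomputable def key (a : WLex) : ℕ ×ₗ Lex (ℕ+ →₀ ℕ) := toLex (wt a.exps, toLex a.exps)

theorem key_injective : Function.Injective key := by
  rintro ⟨a⟩ ⟨b⟩ h
  have h2 : toLex a = toLex b := congrArg (fun p => (ofLex p).2) h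
  exact congrArg mk (toLex.injective h2)

/-- The weighted lexicographic order: weights are compared first, and monomials of equal weight
are compared lexicographically, the exponent of `x_1` being compared first, then that of `x_2`,
and so on. -/
noncomputable instance : LinearOrder WLex := LinearOrder.lift' key key_injective

theorem le_iff_key {a b : WLex} : a ≤ b ↔ key a ≤ key b := Iff.rfl

theorem lt_iff_key {a b : WLex} : a < b ↔ key a < key b := Iff.rfl

theorem key_add (a b : WLex) : key (a + b) = key a + key b := by
  change toLex (wt (a.exps + b.exps), toLex (a.exps + b.exps)) = _
  rw [map_add]
  rfl

instance : IsOrderedAddMonoid WLex where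
  add_le_add_left a b h c := by
    rw [le_iff_key] at h ⊢
    rw [key_add, key_add]
    rw [Prod.Lex.le_iff] at h ⊢
    rcases h with h | ⟨h, h'⟩
    · left
      exact Nat.add_lt_add_right h _
    · right
      exact ⟨congrArg (· + _) h, add_le_add_left h' _⟩

theorem finite_wt_eq (n : ℕ) : {a : WLex | wt a.exps = n}.Finite := by
  have hfin : (Set.Iic (∑ i ∈ Finset.Icc (1 : ℕ+) n.succPNat, Finsupp.single i n)).Finite :=
    Set.finite_Iic _
  refine (hfin.preimage equiv.injective.injOn).subset ?_
  intro a ha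
  have ha' : wt a.exps = n := ha
  change a.exps ≤ _
  intro i
  rw [Finsupp.finsetSum_apply]
  by_cases h0 : a.exps i = 0
  · rw [h0]
    exact Nat.zero_le _
  · have h1 : (i : ℕ) ≤ n := ha' ▸ Finsupp.le_weight_of_ne_zero' (fun i : ℕ+ => (i : ℕ)) h0
    have h2 : a.exps i ≤ n := ha' ▸ Finsupp.le_weight (fun i : ℕ+ => (i : ℕ)) i.ne_zero a.exps
    have hi : i ∈ Finset.Icc (1 : ℕ+) n.succPNat := by
      rw [Finset.mem_Icc, ← PNat.coe_le_coe i, Nat.succPNat_coe]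
      exact ⟨one_le, Nat.le_succ_of_le h1⟩
    rw [Finset.sum_eq_single_of_mem i hi (fun j _ hj => Finsupp.single_eq_of_ne hj.symm),
      Finsupp.single_eq_same]
    exact h2

instance : WellFoundedLT WLex := by
  refine ⟨WellFounded.intro fun a => ?_⟩
  suffices H : ∀ n, ∀ a : WLex, wt a.exps = n → Acc (· < ·) a from H _ a rfl
  intro n
  induction n using Nat.strong_induction_on with
  | _ n ih =>
    have hwf : {a : WLex | wt a.exps = n}.WellFoundedOn (· < ·) :=
      (finite_wt_eq n).isWF
    intro a ha
    refine hwf.induction (P := fun a => Acc (· < ·) a) ha ?_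
    intro b hb ihb
    refine Acc.intro b fun c hc => ?_
    rcases Prod.Lex.lt_iff.mp (lt_iff_key.mp hc) with h | ⟨h, -⟩
    · have h' : wt c.exps < wt b.exps := h
      exact ih _ (lt_of_lt_of_eq h' hb) c rfl
    · have h' : wt c.exps = wt b.exps := h
      exact ihb c (h'.trans hb) hc

end WLex

/-- The weighted lexicographic order on the monomials in `x_1, x_2, …`. -/
noncomputable def weightedLex : MonomialOrder ℕ+ where
  syn := WLex
  toSyn := { toEquiv := WLex.equiv.symm, map_add' := fun _ _ => rfl }
  toSyn_monotone a b h := by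
    change WLex.key ⟨a⟩ ≤ WLex.key ⟨b⟩
    rw [Prod.Lex.le_iff]
    have hw : wt a ≤ wt b := by
      obtain ⟨c, rfl⟩ := exists_add_of_le h
      rw [map_add]
      exact Nat.le_add_right _ _
    rcases hw.lt_or_eq with h' | h'
    · exact Or.inl h'
    · exact Or.inr ⟨h', Finsupp.toLex_monotone h⟩

open scoped MonomialOrder in
theorem weightedLex_lt_iff {a b : ℕ+ →₀ ℕ} :
    a ≺[weightedLex] b ↔ wt a < wt b ∨
      (wt a = wt b ∧ ∃ i, (∀ j < i, a j = b j) ∧ a i < b i) :=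
  (Prod.Lex.lt_iff (x := WLex.key ⟨a⟩) (y := WLex.key ⟨b⟩)).trans Iff.rfl

variable {k : Type*} [Field k]

/-- The `k`-linear derivation of `k[x_1, x_2, …]` with `D x_i = x_{i+1}`. -/
noncomputable def D (k : Type*) [Field k] :
    Derivation k (MvPolynomial ℕ+ k) (MvPolynomial ℕ+ k) :=
  mkDerivation k (fun i : ℕ+ => (X (i + 1) : MvPolynomial ℕ+ k))

/-- The set of the elements of `S` and of all their iterated derivatives. -/
def derivatives (S : Set (MvPolynomial ℕ+ k)) : Set (MvPolynomial ℕ+ k) :=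
  {f | ∃ h ∈ S, ∃ i : ℕ, f = (D k)^[i] h}

/-- The differential ideal `[S]`: the ideal generated by the elements of `S` and by all their
iterated derivatives. -/
noncomputable def diffIdeal (S : Set (MvPolynomial ℕ+ k)) : Ideal (MvPolynomial ℕ+ k) :=
  Ideal.span (derivatives S)

/-- The ideal `(In(f), f ∈ S)`. Over a field the leading term and the leading monomial of a
nonzero polynomial generate the same ideal; the leading term of `0` is `0`. -/
noncomputable def initialSpan (m : MonomialOrder ℕ+) (S : Set (MvPolynomial ℕ+ k)) :
    Ideal (MvPolynomial ℕ+ k) :=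
  Ideal.span (m.leadingTerm '' S)

/-- The initial ideal `In(J)`. -/
noncomputable def initialIdeal (m : MonomialOrder ℕ+) (J : Ideal (MvPolynomial ℕ+ k)) :
    Ideal (MvPolynomial ℕ+ k) :=
  initialSpan m (J : Set (MvPolynomial ℕ+ k))

/-- `J` has a differentially finite Groebner basis for the monomial order `m`: there are finitely
many polynomials that generate `J` as a differential ideal and such that the initial
monomials of their iterated derivatives generate the initial ideal of `J`. -/
def HasDiffFiniteGroebnerBasis (m : MonomialOrder ℕ+) (J : Ideal (MvPolynomial ℕ+ k)) : Prop :=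
  ∃ H : Finset (MvPolynomial ℕ+ k),
    J = diffIdeal (H : Set (MvPolynomial ℕ+ k)) ∧
      initialIdeal m J = initialSpan m (derivatives (H : Set (MvPolynomial ℕ+ k)))

end DiffGroebner

/-!
Let `I = [x_1 ^ 2]`. The derivation `D` does not raise the total degree, so the initial monomials of
the iterated derivatives of finitely many polynomials have bounded degree, and it suffices that
`In(I)` cannot be generated in bounded degree. The powers of the variables already show this.

* Every `x_N` is nilpotent modulo `I`, because in characteristic zero the radical of a differential
  ideal is closed under `D` (`exists_X_pow_mem`). So `In(I)` contains a power of every `x_N`.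
* `I` is homogeneous for the total degree and for the weight, and `x_N ^ e` is the smallest monomial
  of its degree and weight. So `x_N ^ e` lies in `In(I)` only if it lies in `I`
  (`X_pow_mem_of_degree_eq`).
* `x_N ^ N` is not in `I` (`X_pow_notMem`). A homomorphism from `k[x_1, x_2, …] / I` to a commutative
  algebra is a power series `f(t)` with `f(t) ^ 2 = 0`, via `x_{n+1} ↦ n! f_n`. For series `ξ(t)`,
  `η(t)` with anticommuting coefficients, `f = ξ η` has square zero, and `f_n` is the sum of the
  `n + 1` square-zero elements `ξ_a η_b`, `a + b = n`, so `f_n ^ (n + 1)` is `(n + 1)!` times their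
  product, which is nonzero in the exterior algebra.

Hence the generators of `In(I)` that divide powers of `x_N` have degree greater than `N`.
-/

open Finset.HasAntidiagonal (antidiagonal)

universe u

namespace DiffGroebner

/-! ### The general Leibniz rule -/

/-- The general Leibniz rule for a derivation of a commutative algebra. -/
theorem iterate_derivation_mul {k A : Type*} [CommRing k] [CommRing A] [Algebra k A]
    (δ : Derivation k A A) (f g : A) (n : ℕ) :
    δ^[n] (f * g) = ∑ ij ∈ antidiagonal n, (n.choose ij.1 : A) * (δ^[ij.1] f * δ^[ij.2] g) := by
  induction n with
  | zero => simp
  | succ n ih =>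
    rw [Finset.sum_antidiagonal_choose_succ_mul (fun i j => δ^[i] f * δ^[j] g),
      Function.iterate_succ_apply', ih, map_sum, ← Finset.sum_add_distrib]
    refine Finset.sum_congr rfl fun ij hij => ?_
    rw [Nat.choose_symm_of_eq_add (Finset.HasAntidiagonal.mem_antidiagonal.1 hij).symm]
    simp only [Derivation.leibniz, Derivation.map_natCast, smul_eq_mul,
      Function.iterate_succ_apply']
    ring

/-! ### Square-zero power series over commutative algebras -/

/-- In the expansion of the top power of a sum of square-zero elements only the squarefree term
survives. -/
theorem sum_pow_card_of_mul_self_eq_zero {ι A : Type*} [CommRing A] (s : Finset ι)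
    (y : ι → A) (hy : ∀ a ∈ s, y a * y a = 0) :
    (∑ a ∈ s, y a) ^ s.card = (s.card.factorial : A) * ∏ a ∈ s, y a := by
  classical
  induction s using Finset.induction_on with
  | empty => simp
  | insert a s ha ih =>
    have ih' := ih fun b hb => hy b (Finset.mem_insert_of_mem hb)
    have hya : y a * y a = 0 := hy a (Finset.mem_insert_self a s)
    have hprod : (∑ b ∈ s, y b) * ∏ b ∈ s, y b = 0 := by
      rw [Finset.sum_mul]
      refine Finset.sum_eq_zero fun b hb => ?_
      rw [← Finset.mul_prod_erase s y hb, ← mul_assoc,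
        hy b (Finset.mem_insert_of_mem hb), zero_mul]
    have hzero : (∑ b ∈ s, y b) ^ (s.card + 1) = 0 := by
      rw [pow_succ', ih', mul_left_comm, hprod, mul_zero]
    rw [Finset.sum_insert ha, Finset.card_insert_of_notMem ha, Finset.prod_insert ha, add_pow,
      Finset.sum_range_succ', Finset.sum_range_succ', Finset.sum_eq_zero]
    · simp only [Nat.factorial_succ, Nat.cast_mul, Nat.choose_one_right, zero_add, pow_one,
        pow_zero, Nat.add_sub_cancel, Nat.sub_zero, ih', hzero]
      ring
    · intro i _
      rw [pow_succ, pow_succ, mul_assoc (y a ^ i), hya]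
      ring

theorem eq_zero_of_natCast_mul_eq_zero (k : Type*) [Field k] [CharZero k] {A : Type*} [Ring A]
    [Algebra k A] {n : ℕ} (hn : n ≠ 0) {x : A} (h : (n : A) * x = 0) : x = 0 := by
  rw [← map_natCast (algebraMap k A), ← Algebra.smul_def] at h
  exact (smul_eq_zero.mp h).resolve_left (Nat.cast_ne_zero.mpr hn)

theorem eq_zero_of_eq_neg_self (k : Type*) [Field k] [CharZero k] {A : Type*} [Ring A]
    [Algebra k A] {x : A} (h : x = -x) : x = 0 :=
  eq_zero_of_natCast_mul_eq_zero k two_ne_zero <| by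
    rwa [Nat.cast_two, two_mul, ← eq_neg_iff_add_eq_zero]

/-- If `ω a b = ξ_a η_b` with anticommuting `ξ`, `η`, the power series
`∑ ω a b t ^ (a + b) = ξ(t) η(t)` squares to zero. Exchanging the first indices of the two factors
is an involution of the summands of each coefficient that changes their sign. -/
theorem sum_antidiagonal_mul_eq_zero (k : Type*) [Field k] [CharZero k] {A : Type*} [CommRing A]
    [Algebra k A]
    (ω : ℕ → ℕ → A) (hω : ∀ a b c d, ω a b * ω c d = -(ω c b * ω a d)) (n : ℕ) :
    ∑ ij ∈ antidiagonal n, (∑ ab ∈ antidiagonal ij.1, ω ab.1 ab.2) *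
      ∑ cd ∈ antidiagonal ij.2, ω cd.1 cd.2 = 0 := by
  apply eq_zero_of_eq_neg_self k
  simp only [Finset.sum_mul_sum, ← Finset.sum_product', Finset.sum_sigma']
  rw [← Finset.sum_neg_distrib]
  refine Finset.sum_nbij' (fun x => ⟨(x.2.2.1 + x.2.1.2, x.2.1.1 + x.2.2.2),
      ((x.2.2.1, x.2.1.2), (x.2.1.1, x.2.2.2))⟩)
    (fun x => ⟨(x.2.2.1 + x.2.1.2, x.2.1.1 + x.2.2.2),
      ((x.2.2.1, x.2.1.2), (x.2.1.1, x.2.2.2))⟩) ?_ ?_ ?_ ?_ ?_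
  · rintro ⟨⟨i, j⟩, ⟨a, b⟩, ⟨c, d⟩⟩ h
    simp only [Finset.mem_sigma, Finset.mem_product, Finset.HasAntidiagonal.mem_antidiagonal] at h ⊢
    exact ⟨by omega, trivial, trivial⟩
  · rintro ⟨⟨i, j⟩, ⟨a, b⟩, ⟨c, d⟩⟩ h
    simp only [Finset.mem_sigma, Finset.mem_product, Finset.HasAntidiagonal.mem_antidiagonal] at h ⊢
    exact ⟨by omega, trivial, trivial⟩
  · rintro ⟨⟨i, j⟩, ⟨a, b⟩, ⟨c, d⟩⟩ h
    simp only [Finset.mem_sigma, Finset.mem_product, Finset.HasAntidiagonal.mem_antidiagonal] at h ⊢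
    obtain ⟨-, rfl, rfl⟩ := h
    rfl
  · rintro ⟨⟨i, j⟩, ⟨a, b⟩, ⟨c, d⟩⟩ h
    simp only [Finset.mem_sigma, Finset.mem_product, Finset.HasAntidiagonal.mem_antidiagonal] at h ⊢
    obtain ⟨-, rfl, rfl⟩ := h
    rfl
  · rintro ⟨⟨i, j⟩, ⟨a, b⟩, ⟨c, d⟩⟩ -
    exact hω a b c d

/-- The product of the standard basis vectors is nonzero in the exterior algebra, as the
determinant takes the value `1` on it. -/
theorem list_prod_ι_ne_zero (k : Type*) [Field k] (n : ℕ) :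
    (List.ofFn fun p : Fin n => ExteriorAlgebra.ι k (Pi.single p 1 : Fin n → k)).prod ≠ 0 := by
  intro h
  have h1 := ExteriorAlgebra.liftAlternating_apply_ιMulti
    (Pi.single n (Matrix.detRowAlternating (R := k) (n := Fin n)) :
      ∀ i, (Fin n → k) [⋀^Fin i]→ₗ[k] k) (fun p => Pi.single p 1)
  rw [ExteriorAlgebra.ιMulti_apply, h, map_zero, Pi.single_eq_same] at h1
  have h2 : (Matrix.detRowAlternating fun p : Fin n => (Pi.single p 1 : Fin n → k)) = 1 := by
    have : (fun p : Fin n => (Pi.single p 1 : Fin n → k)) = (1 : Matrix (Fin n) (Fin n) k) := by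
      ext i j
      simp [Matrix.one_apply, Pi.single_apply, eq_comm]
    rw [this]
    exact Matrix.det_one
  exact zero_ne_one (h1.trans h2)

open scoped IsMulCommutative in
/-- A commutative algebra with elements `ω a b` that behave like products `ξ_a η_b` of
anticommuting variables, where the products with `a + b = m - 1` multiply to a nonzero element. It
is a subalgebra of the even part of an exterior algebra. -/
theorem exists_commRing_minors (k : Type u) [Field k] (m : ℕ) :
    ∃ (B : Type u) (_ : CommRing B) (_ : Algebra k B) (ω : ℕ → ℕ → B),
      (∀ a b c d, ω a b * ω c d = -(ω c b * ω a d)) ∧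
        ∏ a ∈ Finset.range m, ω a (m - 1 - a) ≠ 0 := by
  -- `v p` is the `p`-th basis vector, and is zero for `p ≥ 2 * m`. The indexing of `η` lists the
  -- vectors of `∏ a, ω a (m - 1 - a)` in their standard order; truncation of the subtraction for
  -- large `b` is harmless, since the relations hold for arbitrary vectors.
  let v : ℕ → Fin (m * 2) → k := fun p q => if (q : ℕ) = p then 1 else 0
  let ξ : ℕ → ExteriorAlgebra k (Fin (m * 2) → k) := fun a => ExteriorAlgebra.ι k (v (a * 2))
  let η : ℕ → ExteriorAlgebra k (Fin (m * 2) → k) := fun b =>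
    ExteriorAlgebra.ι k (v ((m - 1 - b) * 2 + 1))
  have hξ (a c) : ξ a * ξ c = -(ξ c * ξ a) :=
    eq_neg_of_add_eq_zero_left (ExteriorAlgebra.ι_add_mul_swap _ _)
  have hη (a c) : η a * η c = -(η c * η a) :=
    eq_neg_of_add_eq_zero_left (ExteriorAlgebra.ι_add_mul_swap _ _)
  have hξη (a c) : ξ a * η c = -(η c * ξ a) :=
    eq_neg_of_add_eq_zero_left (ExteriorAlgebra.ι_add_mul_swap _ _)
  have hswap (a b c d) : ξ a * η b * (ξ c * η d) = -(ξ c * η b * (ξ a * η d)) := by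
    calc ξ a * η b * (ξ c * η d) = ξ a * (η b * ξ c) * η d := by noncomm_ring
      _ = -(ξ a * ξ c) * η b * η d := by
        rw [← neg_eq_iff_eq_neg.mpr (hξη c b)]; noncomm_ring
      _ = ξ c * (ξ a * η b) * η d := by rw [hξ a c]; noncomm_ring
      _ = _ := by rw [hξη a b]; noncomm_ring
  have hcomm (a b c d) : ξ a * η b * (ξ c * η d) = ξ c * η d * (ξ a * η b) := by
    calc ξ a * η b * (ξ c * η d) = -(ξ c * (η b * ξ a) * η d) := by
          rw [hswap]; noncomm_ring
      _ = ξ c * ξ a * (η b * η d) := by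
        rw [← neg_eq_iff_eq_neg.mpr (hξη a b)]; noncomm_ring
      _ = -(ξ c * (ξ a * η d) * η b) := by rw [hη b d]; noncomm_ring
      _ = _ := by rw [hξη a d]; noncomm_ring
  let s : Set (ExteriorAlgebra k (Fin (m * 2) → k)) :=
    Set.range fun ab : ℕ × ℕ => ξ ab.1 * η ab.2
  have : IsMulCommutative (Algebra.adjoin k s) := Algebra.isMulCommutative_adjoin k <| by
    rintro _ ⟨⟨a, b⟩, rfl⟩ _ ⟨⟨c, d⟩, rfl⟩
    exact hcomm a b c d
  refine ⟨Algebra.adjoin k s, inferInstance, inferInstance,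
    fun a b => ⟨ξ a * η b, Algebra.subset_adjoin ⟨(a, b), rfl⟩⟩,
    fun a b c d => Subtype.ext (hswap a b c d), fun h => ?_⟩
  apply list_prod_ι_ne_zero k (m * 2)
  have h' := congrArg (Algebra.adjoin k s).val h
  rw [Finset.prod_range, ← List.prod_ofFn, map_list_prod, map_zero] at h'
  rw [List.ofFn_mul, List.prod_flatten, ← h', List.map_ofFn, List.map_ofFn]
  have hv (p : Fin (m * 2)) : (Pi.single p 1 : Fin (m * 2) → k) = v p := by
    ext q
    simp [v, Pi.single_apply, Fin.ext_iff]
  congr 2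
  funext i
  have hi : m - 1 - (m - 1 - (i : ℕ)) = i := by omega
  simp [hv, ξ, η, hi]

variable {k : Type*} [Field k]

/-! ### The derivation and its iterates -/

theorem D_X (i : ℕ+) : D k (X i) = X (i + 1) := mkDerivation_X _ _ _

theorem D_iterate_X_one (n : ℕ) : (D k)^[n] (X 1) = X n.succPNat := by
  induction n with
  | zero => rfl
  | succ n ih =>
    rw [Function.iterate_succ_apply', ih, D_X]
    rfl

theorem D_iterate_X_one_sq (n : ℕ) :
    (D k)^[n] (X 1 ^ 2) = ∑ ij ∈ antidiagonal n,
      (n.choose ij.1 : MvPolynomial ℕ+ k) * (X ij.1.succPNat * X ij.2.succPNat) := by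
  rw [sq, iterate_derivation_mul]
  simp only [D_iterate_X_one]

theorem totalDegree_D_le (f : MvPolynomial ℕ+ k) : (D k f).totalDegree ≤ f.totalDegree := by
  conv_lhs => rw [f.as_sum, map_sum]
  refine totalDegree_finsetSum_le fun s hs => ?_
  refine le_trans ?_ (le_totalDegree hs)
  rw [D, mkDerivation_monomial]
  refine (totalDegree_smul_le _ _).trans (totalDegree_finsetSum_le fun i hi => ?_)
  simp only [smul_eq_mul]
  refine (totalDegree_mul _ _).trans ?_
  rw [totalDegree_X]
  refine (add_le_add_left (totalDegree_monomial_le _ _) 1).trans ?_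
  have h1 : s - Finsupp.single i 1 + Finsupp.single i 1 = s :=
    Finsupp.sub_add_single_one_cancel (Finsupp.mem_support_iff.mp hi)
  have h2 := congrArg Finsupp.degree h1
  rw [map_add, Finsupp.degree_single] at h2
  exact h2.le

theorem totalDegree_D_iterate_le (f : MvPolynomial ℕ+ k) (n : ℕ) :
    ((D k)^[n] f).totalDegree ≤ f.totalDegree := by
  induction n with
  | zero => exact le_rfl
  | succ n ih =>
    rw [Function.iterate_succ_apply']
    exact (totalDegree_D_le _).trans ih

/-! ### Powers of the variables in the differential ideal -/

theorem D_mem_diffIdeal {S : Set (MvPolynomial ℕ+ k)} {f : MvPolynomial ℕ+ k}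
    (hf : f ∈ diffIdeal S) : D k f ∈ diffIdeal S := by
  rw [diffIdeal] at hf
  induction hf using Submodule.span_induction with
  | mem g hg =>
    obtain ⟨h, hh, i, rfl⟩ := hg
    exact Ideal.subset_span ⟨h, hh, i + 1, (Function.iterate_succ_apply' _ _ _).symm⟩
  | zero => simp
  | add f g _ _ hf hg => simpa using add_mem hf hg
  | smul a g hg h =>
    rw [smul_eq_mul, Derivation.leibniz, smul_eq_mul, smul_eq_mul]
    exact add_mem (Ideal.mul_mem_left _ _ h) (Ideal.mul_mem_right _ _ hg)

/-- In characteristic zero, each factor `f` of a power of `f` in a differential ideal can be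
traded for two factors `D f`. For `j = n` this gives `(D f) ^ (2 * n)`, so the radical is closed
under `D`. -/
theorem pow_mul_D_pow_mem [CharZero k] {S : Set (MvPolynomial ℕ+ k)} {f : MvPolynomial ℕ+ k}
    {n : ℕ} (hf : f ^ n ∈ diffIdeal S) (j : ℕ) (hj : j ≤ n) :
    f ^ (n - j) * D k f ^ (2 * j) ∈ diffIdeal S := by
  induction j with
  | zero => simpa using hf
  | succ j ih =>
    obtain ⟨l, rfl⟩ := Nat.exists_eq_add_of_le' hj
    have h0 := ih (by omega)
    rw [show l + (j + 1) - j = l + 1 by omega] at h0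
    rw [show l + (j + 1) - (j + 1) = l by omega]
    -- Differentiate, multiply by `D f`, and cancel the term that contains `D (D f)`.
    have h1 := Ideal.mul_mem_right (D k f) _ (D_mem_diffIdeal h0)
    have h2 := Ideal.mul_mem_right (2 * j * D k (D k f)) _ h0
    have h3 : ((l + 1 : ℕ) : MvPolynomial ℕ+ k) * (f ^ l * D k f ^ (2 * (j + 1)))
        ∈ diffIdeal S := by
      convert sub_mem h1 h2 using 1
      rcases j with _ | j
      · simp [Derivation.leibniz_pow]
        ring
      · simp only [Derivation.leibniz, Derivation.leibniz_pow, smul_eq_mul, nsmul_eq_mul,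
          show 2 * (j + 1) - 1 = 2 * j + 1 by omega, Nat.add_sub_cancel]
        push_cast
        ring
    have hu : C ((l + 1 : ℕ) : k)⁻¹ * ((l + 1 : ℕ) : MvPolynomial ℕ+ k) = 1 := by
      rw [← map_natCast C, ← C_mul, inv_mul_cancel₀ (Nat.cast_ne_zero.mpr l.succ_ne_zero), C_1]
    have h4 := Ideal.mul_mem_left _ (C ((l + 1 : ℕ) : k)⁻¹) h3
    rwa [← mul_assoc, hu, one_mul] at h4

theorem exists_X_pow_mem [CharZero k] (i : ℕ+) :
    ∃ n, (X i : MvPolynomial ℕ+ k) ^ n ∈ diffIdeal {(X 1 ^ 2 : MvPolynomial ℕ+ k)} := by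
  induction i using PNat.recOn with
  | one => exact ⟨2, Ideal.subset_span ⟨_, rfl, 0, rfl⟩⟩
  | succ i ih =>
    obtain ⟨n, hn⟩ := ih
    refine ⟨2 * n, ?_⟩
    simpa [D_X] using pow_mul_D_pow_mem hn n le_rfl

/-- The homomorphism `x_{n+1} ↦ n! ∑_{a+b=n} ξ_a η_b` to an algebra of even elements of an exterior
algebra kills `[x_1 ^ 2]`, because `ξ(t) η(t)` has square zero. It maps `x_i ^ i` to a nonzero
multiple of the product of the `i` square-zero elements `ξ_a η_b` with `a + b = i - 1`. -/
theorem X_pow_notMem [CharZero k] (i : ℕ+) :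
    (X i : MvPolynomial ℕ+ k) ^ (i : ℕ) ∉ diffIdeal {(X 1 ^ 2 : MvPolynomial ℕ+ k)} := by
  obtain ⟨B, _, _, ω, hω, hprod⟩ := exists_commRing_minors k (i : ℕ)
  let F : ℕ → B := fun n => ∑ ab ∈ antidiagonal n, ω ab.1 ab.2
  let φ : MvPolynomial ℕ+ k →ₐ[k] B :=
    aeval fun j : ℕ+ => (j.natPred.factorial : B) * F j.natPred
  have hker : diffIdeal {(X 1 ^ 2 : MvPolynomial ℕ+ k)} ≤ RingHom.ker φ := by
    refine Ideal.span_le.mpr ?_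
    rintro _ ⟨_, rfl, n, rfl⟩
    rw [SetLike.mem_coe, RingHom.mem_ker, D_iterate_X_one_sq, map_sum]
    calc _ = ∑ ij ∈ antidiagonal n, (n.factorial : B) * (F ij.1 * F ij.2) := by
          refine Finset.sum_congr rfl fun ij hij => ?_
          rw [Finset.HasAntidiagonal.mem_antidiagonal] at hij
          rw [← hij, ← Nat.add_choose_mul_factorial_mul_factorial ij.1 ij.2]
          simp only [map_mul, map_natCast, φ, aeval_X, Nat.natPred_succPNat]
          rw [Nat.choose_symm_add]
          push_cast
          ring
      _ = 0 := by rw [← Finset.mul_sum, sum_antidiagonal_mul_eq_zero k ω hω, mul_zero]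
  intro hmem
  have h0 : φ (X i ^ (i : ℕ)) = 0 := hker hmem
  have hF : F i.natPred ^ (i : ℕ) =
      ((i : ℕ).factorial : B) * ∏ a ∈ Finset.range i, ω a (i - 1 - a) := by
    have h := sum_pow_card_of_mul_self_eq_zero (Finset.range i) (fun a => ω a (i - 1 - a))
      fun a _ => eq_zero_of_eq_neg_self k (hω _ _ _ _)
    rw [Finset.card_range] at h
    rw [← h]
    congr 1
    simp only [F]
    rw [Finset.Nat.sum_antidiagonal_eq_sum_range_succ ω, Nat.succ_eq_add_one, PNat.natPred_add_one]
    rfl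
  rw [map_pow, aeval_X, mul_pow, hF, ← Nat.cast_pow] at h0
  exact hprod <| eq_zero_of_natCast_mul_eq_zero k (Nat.factorial_ne_zero _) <|
    eq_zero_of_natCast_mul_eq_zero k (pow_ne_zero _ (Nat.factorial_ne_zero _)) h0

/-! ### Bihomogeneity and initial monomials -/

/-- The weight `(1, i)` of `x_i`: the corresponding weighted degree of a monomial records both its
total degree and its weight. -/
def bidegree (i : ℕ+) : ℕ × ℕ := (1, i)

theorem weight_bidegree (s : ℕ+ →₀ ℕ) : Finsupp.weight bidegree s = (s.degree, wt s) := by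
  simp [wt, Finsupp.weight_apply, Finsupp.sum, bidegree, Prod.ext_iff, Prod.fst_sum, Prod.snd_sum,
    Finsupp.degree_apply]

/-- `[x_1 ^ 2]` is bihomogeneous. -/
theorem weightedHomogeneousComponent_mem_diffIdeal {f : MvPolynomial ℕ+ k}
    (hf : f ∈ diffIdeal {(X 1 ^ 2 : MvPolynomial ℕ+ k)}) (d : ℕ × ℕ) :
    weightedHomogeneousComponent bidegree d f ∈ diffIdeal {(X 1 ^ 2 : MvPolynomial ℕ+ k)} := by
  let _ := weightedGradedAlgebra k bidegree
  refine weightedHomogeneousComponent_mem_of_mem k bidegree (Ideal.homogeneous_span _ _ ?_) hf d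
  rintro _ ⟨_, rfl, n, rfl⟩
  refine ⟨(2, n + 2), ?_⟩
  rw [D_iterate_X_one_sq]
  refine IsWeightedHomogeneous.sum _ _ _ fun ij hij => ?_
  rw [← map_natCast C]
  refine IsWeightedHomogeneous.C_mul ?_ _
  have h := (isWeightedHomogeneous_X k bidegree ij.1.succPNat).mul
    (isWeightedHomogeneous_X k bidegree ij.2.succPNat)
  convert h using 1
  rw [Finset.HasAntidiagonal.mem_antidiagonal] at hij
  simp only [bidegree, Prod.mk_add_mk, Nat.succPNat_coe]
  ext <;> simp; omega

open scoped MonomialOrder in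
/-- Among the monomials with the total degree and the weight of `x_N ^ e`, the monomial `x_N ^ e` is
the smallest: a smaller one involves only `x_N, x_{N+1}, …`, so its weight is at least `N` times its
degree, with equality only for powers of `x_N`. -/
theorem eq_single_of_le {N : ℕ+} {e : ℕ} {s : ℕ+ →₀ ℕ} (hdeg : s.degree = e)
    (hwt : wt s = wt (Finsupp.single N e)) (hle : s ≼[weightedLex] Finsupp.single N e) :
    s = Finsupp.single N e := by
  by_contra hne
  have hlt : s ≺[weightedLex] Finsupp.single N e :=
    lt_of_le_of_ne hle fun h => hne (weightedLex.toSyn.injective h)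
  obtain h | ⟨-, i, hi, hlt⟩ := weightedLex_lt_iff.mp hlt
  · exact h.ne hwt
  obtain rfl : N = i := by
    by_contra h
    rw [Finsupp.single_eq_of_ne (Ne.symm h)] at hlt
    exact absurd hlt (Nat.not_lt_zero _)
  rw [Finsupp.single_eq_same] at hlt
  have hge : ∀ j ∈ s.support, N ≤ j := by
    intro j hj
    by_contra! h
    rw [Finsupp.mem_support_iff, hi j h, Finsupp.single_eq_of_ne h.ne] at hj
    exact hj rfl
  have hw1 : wt s = ∑ j ∈ s.support, s j * (j : ℕ) := by
    simp [wt, Finsupp.weight_apply, Finsupp.sum]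
  have hw2 : wt (Finsupp.single N e) = ∑ j ∈ s.support, s j * (N : ℕ) := by
    rw [wt, Finsupp.weight_single, ← Finset.sum_mul, ← hdeg]
    rfl
  rw [hw1, hw2] at hwt
  have hall := (Finset.sum_eq_sum_iff_of_le fun j hj =>
    Nat.mul_le_mul_left (s j) (PNat.coe_le_coe _ _ |>.mpr (hge j hj))).mp hwt.symm
  have hs : s = Finsupp.single N (s N) := by
    ext j
    by_cases hj : j = N
    · simp [hj]
    · rw [Finsupp.single_eq_of_ne hj]
      by_contra h0
      have := Nat.eq_of_mul_eq_mul_left (Nat.pos_of_ne_zero h0)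
        (hall j (Finsupp.mem_support_iff.mpr h0))
      exact hj (PNat.coe_injective this.symm)
  rw [hs, Finsupp.degree_single] at hdeg
  exact hlt.ne hdeg

/-- A power of a variable that is the initial monomial of an element of `[x_1 ^ 2]` lies itself in
`[x_1 ^ 2]`: it is, up to a scalar, a bihomogeneous component of that element. -/
theorem X_pow_mem_of_degree_eq {f : MvPolynomial ℕ+ k} {N : ℕ+} {e : ℕ} (h0 : f ≠ 0)
    (hf : f ∈ diffIdeal {(X 1 ^ 2 : MvPolynomial ℕ+ k)})
    (hdeg : weightedLex.degree f = Finsupp.single N e) :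
    (X N : MvPolynomial ℕ+ k) ^ e ∈ diffIdeal {(X 1 ^ 2 : MvPolynomial ℕ+ k)} := by
  classical
  have hc := weightedHomogeneousComponent_mem_diffIdeal hf
    (Finsupp.weight bidegree (Finsupp.single N e))
  have hcomp : weightedHomogeneousComponent bidegree
      (Finsupp.weight bidegree (Finsupp.single N e)) f =
      C (weightedLex.leadingCoeff f) * X N ^ e := by
    rw [X_pow_eq_monomial, C_mul_monomial, mul_one]
    ext s
    rw [coeff_weightedHomogeneousComponent, coeff_monomial]
    by_cases hs : Finsupp.single N e = s
    · subst hs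
      rw [if_pos rfl, if_pos rfl, MonomialOrder.leadingCoeff, hdeg]
    · rw [if_neg hs, ite_eq_right_iff]
      intro hw
      by_contra hcoeff
      rw [weight_bidegree, weight_bidegree, Prod.mk.injEq, Finsupp.degree_single] at hw
      exact hs (eq_single_of_le hw.1 hw.2
        (hdeg ▸ weightedLex.le_degree (mem_support_iff.mpr hcoeff))).symm
  rw [hcomp] at hc
  have h := Ideal.mul_mem_left _ (C (weightedLex.leadingCoeff f)⁻¹) hc
  rwa [← mul_assoc, ← C_mul, inv_mul_cancel₀ (weightedLex.leadingCoeff_ne_zero_iff.mpr h0), C_1,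
    one_mul] at h

theorem exists_degree_le_of_monomial_mem {m : MonomialOrder ℕ+} {S : Set (MvPolynomial ℕ+ k)}
    {a : ℕ+ →₀ ℕ} {c : k} (hc : c ≠ 0) (h : monomial a c ∈ initialSpan m S) :
    ∃ g ∈ S, g ≠ 0 ∧ m.degree g ≤ a := by
  classical
  rw [initialSpan, MonomialOrder.span_leadingTerm_eq_span_monomial',
    ← Set.image_image (fun s => monomial s (1 : k)) m.degree, mem_ideal_span_monomial_image] at h
  obtain ⟨_, ⟨g, ⟨hg, hg0⟩, rfl⟩, hle⟩ := h a (by simp [support_monomial, hc])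
  exact ⟨g, hg, hg0, hle⟩

/-- No finite set `H` works: the iterated derivatives of its elements have degree at most some `N`,
so the generator of `In(I)` that divides a power of `x_N` in `I` is an `x_N ^ e` with `e ≤ N`, and
this forces `x_N ^ N ∈ I`. -/
theorem initialIdeal_ne [CharZero k] (H : Finset (MvPolynomial ℕ+ k)) :
    initialIdeal weightedLex (diffIdeal {(X 1 ^ 2 : MvPolynomial ℕ+ k)}) ≠
      initialSpan weightedLex (derivatives (H : Set (MvPolynomial ℕ+ k))) := by
  intro heq
  -- The successor only serves to make the bound positive.
  set N : ℕ+ := (H.sup totalDegree).succPNat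
  have hN : ∀ h ∈ H, h.totalDegree ≤ (N : ℕ) := fun h hh =>
    (Finset.le_sup hh).trans (Nat.le_succ _)
  obtain ⟨M, hM⟩ := exists_X_pow_mem (k := k) N
  have h1 : (monomial (Finsupp.single N M) 1 : MvPolynomial ℕ+ k) ∈
      initialSpan weightedLex (derivatives (H : Set (MvPolynomial ℕ+ k))) := by
    rw [← heq]
    refine Ideal.subset_span ⟨X N ^ M, hM, ?_⟩
    rw [X_pow_eq_monomial, MonomialOrder.leadingTerm_monomial]
  obtain ⟨_, ⟨h, hh, i, rfl⟩, hg0, hle⟩ := exists_degree_le_of_monomial_mem one_ne_zero h1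
  set g := (D k)^[i] h
  have h2 : weightedLex.leadingTerm g ∈
      initialIdeal weightedLex (diffIdeal {(X 1 ^ 2 : MvPolynomial ℕ+ k)}) := by
    rw [heq]
    exact Ideal.subset_span ⟨g, ⟨h, hh, i, rfl⟩, rfl⟩
  -- `g` need not lie in the ideal, but its leading term is divisible by that of some `f` in the
  -- ideal.
  obtain ⟨f, hf, hf0, hfg⟩ :=
    exists_degree_le_of_monomial_mem (weightedLex.leadingCoeff_ne_zero_iff.mpr hg0) h2
  obtain ⟨e, he⟩ : ∃ e, weightedLex.degree f = Finsupp.single N e := by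
    refine ⟨weightedLex.degree f N, ?_⟩
    ext j
    by_cases hj : j = N
    · simp [hj]
    · have := (hfg.trans hle) j
      rw [Finsupp.single_eq_of_ne hj] at this ⊢
      exact Nat.le_zero.mp this
  have heN : e ≤ (N : ℕ) := calc
    e = (weightedLex.degree f).degree := by rw [he, Finsupp.degree_single]
    _ ≤ (weightedLex.degree g).degree := Finsupp.degree_mono hfg
    _ ≤ g.totalDegree := le_totalDegree (weightedLex.degree_mem_support hg0)
    _ ≤ h.totalDegree := totalDegree_D_iterate_le h i
    _ ≤ N := hN h hh
  exact X_pow_notMem N (Ideal.pow_mem_of_pow_mem _ (X_pow_mem_of_degree_eq hf0 hf he) heN)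

end DiffGroebner

theorem theorem2p2 (k : Type*) [Field k] [CharZero k] :
    ¬ DiffGroebner.HasDiffFiniteGroebnerBasis DiffGroebner.weightedLex
        (DiffGroebner.diffIdeal {(X 1 ^ 2 : MvPolynomial ℕ+ k)}) ∧
    ∀ H : Finset (MvPolynomial ℕ+ k),
      DiffGroebner.initialIdeal DiffGroebner.weightedLex
          (DiffGroebner.diffIdeal {(X 1 ^ 2 : MvPolynomial ℕ+ k)}) ≠
        DiffGroebner.initialSpan DiffGroebner.weightedLex
          (DiffGroebner.derivatives (H : Set (MvPolynomial ℕ+ k))) := by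
  refine ⟨?_, DiffGroebner.initialIdeal_ne⟩
  rintro ⟨H, -, hH⟩
  exact DiffGroebner.initialIdeal_ne H hH
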